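/- A permutation $p=p_1p_2\cdots p_n$ of $\{1,\dots,n\}$ contains an occurrence of a pattern $q=q_1\cdots q_k$ (a permutation of $\{1,\dots,k\}$) at positions $i_1<\cdots<i_k$ if $p_{i_1},\dots,p_{i_k}$ are in the same relative order as $q_1,\dots,q_k$; it avoids $q$ if it contains no occurrence of $q$. For $n\ge 0$ let $\mathrm{Av}_n(123)$ be the set of permutations of $\{1,\dots,n\}$ avoiding $123$, and let $a_n$ be the total number of occurrences of the pattern $213$ in all the permutations in $\mathrm{Av}_n(123)$. Let $C(x)=\sum_{n\ge 0}\frac{1}{n+1}\binom{2n}{n}x^n$ be the generating function of the Catalan numbers. Then, as formal power series over $\mathbb{Q}$, $$\sum_{n\ge 0}a_nx^n=\frac{x^3C(x)^3}{(1-4x)^{3/2}}=\frac{x-1}{2(1-4x)}-\frac{3x-1}{2(1-4x)^{3/2}},$$ where $(1-4x)^{3/2}=\sum_{n\ge 0}\binom{3/2}{n}(-4x)^n$. -/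

import Mathlib

open PowerSeries

/-- An occurrence of the pattern `q` in the permutation `p`: an increasing choice of positions
`f 0 < f 1 < ⋯ < f (k - 1)` whose entries in `p` are in the same relative order as the
entries of `q`. Permutations are read in one-line notation `p 0, p 1, …`, with letters
`0, …, n - 1` in place of `1, …, n`. -/
def IsOccurrence {k n : ℕ} (q : Equiv.Perm (Fin k)) (p : Equiv.Perm (Fin n))
    (f : Fin k → Fin n) : Prop :=
  (∀ i j, i < j → f i < f j) ∧ ∀ i j, p (f i) < p (f j) ↔ q i < q j

instance {k n : ℕ} (q : Equiv.Perm (Fin k)) (p : Equiv.Perm (Fin n)) :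
    DecidablePred (IsOccurrence q p) := fun f => by
  unfold IsOccurrence
  infer_instance

/-- The number of occurrences of the pattern `q` in the permutation `p`. -/
def numOcc {k n : ℕ} (q : Equiv.Perm (Fin k)) (p : Equiv.Perm (Fin n)) : ℕ :=
  (Finset.univ.filter (IsOccurrence q p)).card

/-- The `n`-permutations that avoid the pattern `q`. -/
def Av {k : ℕ} (n : ℕ) (q : Equiv.Perm (Fin k)) : Finset (Equiv.Perm (Fin n)) :=
  Finset.univ.filter fun p => ∀ f, ¬ IsOccurrence q p f

/-- The total number of occurrences of `q` in a finite set of `n`-permutations. -/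
def totalOcc {k n : ℕ} (q : Equiv.Perm (Fin k)) (S : Finset (Equiv.Perm (Fin n))) : ℕ :=
  ∑ p ∈ S, numOcc q p

/-- The pattern `123`, the identity. -/
def pat123 : Equiv.Perm (Fin 3) := 1

/-- The pattern `213`, which exchanges the first two letters. -/
def pat213 : Equiv.Perm (Fin 3) := Equiv.swap 0 1

/-- The Catalan generating function `C(x) = ∑ cₙ xⁿ` over `ℚ`. -/
noncomputable def catalanGF : ℚ⟦X⟧ := PowerSeries.mk fun n => (catalan n : ℚ)

/-- The formal power series `(1 - 4x)^r = ∑ binom(r, n) (-4x)ⁿ`, for a rational exponent `r`. -/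
noncomputable def oneSubFourXPow (r : ℚ) : ℚ⟦X⟧ :=
  PowerSeries.rescale (-4 : ℚ) (PowerSeries.binomialSeries ℚ r)

/-! Permutations grow by a new first entry with `i` larger entries. The result avoids 123 exactly
when `p` does and its `i` largest entries decrease, so all sums are refined by a parameter `m`: the
`m` largest entries decrease. Differencing in `m` leaves a single insertion index
(`topSum_succ_sub`). A new first entry creates occurrences of 213 only as the letter 2, one for each
crossing pair, so the three quantities to solve for are the count, `crossPairs` and `numOcc`. With
`t = xC`, one has `x = t(1 - t)`, `C = 1/(1 - t)` and `√(1 - 4x) = 1 - 2t`. The generating functions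
in `n` are `t^m C` for the count, `t^m (C - 1) C j(j+1)/2` for `crossPairs j` with `j ≤ m`, and `t^m
Q(m)` with `Q` cubic for `numOcc`. The answer is `Q(0) = t³/(1 - 2t)³`. -/

/-- `frontInsert i p` puts a new first entry in front of `p`, with exactly `i` larger entries
(for `i ≤ n`). -/
def frontInsert {n : ℕ} (i : ℕ) (p : Equiv.Perm (Fin n)) : Equiv.Perm (Fin (n + 1)) :=
  ((finSuccEquiv' 0).trans p.optionCongr).trans
    (finSuccEquiv' (⟨n - i, by omega⟩ : Fin (n + 1))).symm

lemma frontInsert_zero {n : ℕ} (i : ℕ) (p : Equiv.Perm (Fin n)) :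
    ((frontInsert i p 0 : Fin (n + 1)) : ℕ) = n - i := by
  simp [frontInsert]

lemma frontInsert_succ' {n : ℕ} (i : ℕ) (p : Equiv.Perm (Fin n)) (a : Fin n) :
    frontInsert i p a.succ = (⟨n - i, by omega⟩ : Fin (n + 1)).succAbove (p a) := by
  have : finSuccEquiv' (0 : Fin (n + 1)) a.succ = some a := by
    rw [← Fin.zero_succAbove, finSuccEquiv'_succAbove]
  simp [frontInsert, this]

lemma frontInsert_succ {n i : ℕ} (hi : i ≤ n) (p : Equiv.Perm (Fin n)) (a : Fin n) :
    ((frontInsert i p a.succ : Fin (n + 1)) : ℕ) =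
      if (p a : ℕ) + i < n then (p a : ℕ) else (p a : ℕ) + 1 := by
  rw [frontInsert_succ', Fin.succAbove]
  simp only [Fin.lt_def, Fin.val_castSucc]
  split_ifs <;> first | rfl | omega

lemma frontInsert_bijective (n : ℕ) :
    Function.Bijective (fun x : Fin (n + 1) × Equiv.Perm (Fin n) => frontInsert x.1 x.2) := by
  rw [Fintype.bijective_iff_injective_and_card]
  refine ⟨?_, by simp [Fintype.card_perm, Nat.factorial_succ]⟩
  rintro ⟨i, p⟩ ⟨j, r⟩ h
  simp only at h
  have h0 := congrArg (fun q => ((q 0 : Fin (n + 1)) : ℕ)) h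
  simp only [frontInsert_zero] at h0
  have hij : i = j := by ext; omega
  subst hij
  congr 1
  ext1 a
  have ha := congrArg (fun q => q a.succ) h
  simp only [frontInsert_succ'] at ha
  exact Fin.succAbove_right_injective ha

lemma sum_perm_succ {n : ℕ} (g : Equiv.Perm (Fin (n + 1)) → ℚ) :
    ∑ q, g q = ∑ i ∈ Finset.range (n + 1), ∑ p : Equiv.Perm (Fin n), g (frontInsert i p) := by
  rw [Finset.sum_range (fun i => ∑ p : Equiv.Perm (Fin n), g (frontInsert i p)),
    ← Fintype.sum_prod_type']
  exact ((frontInsert_bijective n).sum_comp g).symm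

/-! ### Avoidance and decreasing top entries under insertion. -/

/-- The permutation `p` avoids `123`. -/
def Avoids123 {n : ℕ} (p : Equiv.Perm (Fin n)) : Prop :=
  ∀ a b c, a < b → b < c → p a < p b → ¬ p b < p c

/-- The `m` largest entries of `p` appear in decreasing order. -/
def TopDecreasing {n : ℕ} (m : ℕ) (p : Equiv.Perm (Fin n)) : Prop :=
  -- The clause `m ≤ n` makes every refined sum vanish for `m > n`, which anchors the difference
  -- equations in `m`.
  m ≤ n ∧ ∀ a b, a < b → n ≤ (p a : ℕ) + m → n ≤ (p b : ℕ) + m → p b < p a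

lemma mem_Av_pat123 {n : ℕ} (p : Equiv.Perm (Fin n)) : p ∈ Av n pat123 ↔ Avoids123 p := by
  rw [Av, Finset.mem_filter_univ]
  simp only [IsOccurrence, Avoids123, pat123, Equiv.Perm.one_apply]
  constructor
  · intro h a b c hab hbc pab pbc
    refine h ![a, b, c] ⟨?_, ?_⟩
    · intro i j hij
      fin_cases i <;> fin_cases j <;> (simp_all; try exact hab.trans hbc)
    · have := pab.trans pbc
      intro i j
      fin_cases i <;> fin_cases j <;> simp [*, le_of_lt]
  · intro h f ⟨h1, h2⟩
    exact h (f 0) (f 1) (f 2) (h1 _ _ (by decide)) (h1 _ _ (by decide))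
      ((h2 _ _).2 (by decide)) ((h2 _ _).2 (by decide))

/-- The new first entry can only be the 1 of a 123, and then the other two letters form an ascent
among the `i` largest entries of `p`. -/
lemma avoids123_frontInsert {n i : ℕ} (hi : i ≤ n) (p : Equiv.Perm (Fin n)) :
    Avoids123 (frontInsert i p) ↔ Avoids123 p ∧ TopDecreasing i p := by
  constructor
  · intro h
    refine ⟨fun a b c hab hbc pab pbc => ?_, hi, fun a b hab ha hb => ?_⟩
    · refine h a.succ b.succ c.succ (by simpa) (by simpa) ?_ ?_ <;>
      · rw [Fin.lt_def] at pab pbc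
        rw [Fin.lt_def, frontInsert_succ hi, frontInsert_succ hi]
        split_ifs <;> omega
    · by_contra hlt
      have hne : p a ≠ p b := fun e => hab.ne (p.injective e)
      refine h 0 a.succ b.succ (Fin.succ_pos a) (by simpa) ?_ ?_
      · rw [Fin.lt_def, frontInsert_zero, frontInsert_succ hi]
        split_ifs <;> omega
      · rw [Fin.lt_def, frontInsert_succ hi, frontInsert_succ hi]
        split_ifs <;> omega
  · rintro ⟨h, -, ht⟩ a b c hab hbc pab pbc
    obtain ⟨b, rfl⟩ := Fin.eq_succ_of_ne_zero (Fin.ne_zero_of_lt hab)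
    obtain ⟨c, rfl⟩ := Fin.eq_succ_of_ne_zero (Fin.ne_zero_of_lt hbc)
    rw [Fin.lt_def, frontInsert_succ hi, frontInsert_succ hi] at pbc
    rw [Fin.succ_lt_succ_iff] at hbc
    rcases Fin.eq_zero_or_eq_succ a with rfl | ⟨a, rfl⟩
    · rw [Fin.lt_def, frontInsert_zero, frontInsert_succ hi] at pab
      have := ht b c hbc (by split_ifs at pab <;> omega) (by split_ifs at pab pbc <;> omega)
      split_ifs at pbc <;> omega
    · rw [Fin.lt_def, frontInsert_succ hi, frontInsert_succ hi] at pab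
      refine h a b c (by simpa using hab) hbc ?_ ?_
      · split_ifs at pab <;> omega
      · split_ifs at pbc <;> omega

lemma topDecreasing_zero {n : ℕ} (p : Equiv.Perm (Fin n)) : TopDecreasing 0 p :=
  ⟨n.zero_le, fun a b _ ha _ => by omega⟩

lemma topDecreasing_one {n : ℕ} (p : Equiv.Perm (Fin (n + 1))) : TopDecreasing 1 p :=
  ⟨by omega, fun a b hab ha hb => by
    have : p a ≠ p b := fun e => hab.ne (p.injective e)
    omega⟩

lemma topDecreasing_frontInsert_zero {n m : ℕ} (p : Equiv.Perm (Fin n)) :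
    TopDecreasing (m + 1) (frontInsert 0 p) ↔ TopDecreasing m p := by
  constructor
  · rintro ⟨hm, h⟩
    refine ⟨by omega, fun a b hab ha hb => ?_⟩
    have := h a.succ b.succ (by simpa)
    rw [Fin.lt_def, frontInsert_succ n.zero_le, frontInsert_succ n.zero_le] at this
    simp only [add_zero, Fin.is_lt, if_true] at this
    exact this (by omega) (by omega)
  · rintro ⟨hm, h⟩
    refine ⟨by omega, fun a b hab ha hb => ?_⟩
    obtain ⟨b, rfl⟩ := Fin.eq_succ_of_ne_zero (Fin.ne_zero_of_lt hab)
    rw [frontInsert_succ n.zero_le] at hb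
    rw [Fin.lt_def, frontInsert_succ n.zero_le]
    simp only [add_zero, Fin.is_lt, if_true] at hb ⊢
    rcases Fin.eq_zero_or_eq_succ a with rfl | ⟨a, rfl⟩
    · rw [frontInsert_zero]; omega
    · rw [frontInsert_succ n.zero_le] at ha ⊢
      simp only [add_zero, Fin.is_lt, if_true] at ha ⊢
      exact h a b (by simpa using hab) (by omega) (by omega)

/-- For `m ≤ i` the top `m` entries are old ones. For `m > i` the new entry is among them and
precedes the maximum, which is old because `i ≠ 0`. -/
lemma topDecreasing_frontInsert {n m i : ℕ} (hi0 : i ≠ 0) {p : Equiv.Perm (Fin n)}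
    (hp : TopDecreasing i p) :
    TopDecreasing m (frontInsert i p) ↔ m ≤ i := by
  have hi := hp.1
  constructor
  · rintro ⟨hm, h⟩
    by_contra hlt
    have hn : 0 < n := by omega
    -- `p.symm ⟨n - 1, _⟩` is the position of the maximum of `p`.
    have := h 0 (p.symm ⟨n - 1, by omega⟩).succ (Fin.succ_pos _)
    rw [Fin.lt_def, frontInsert_zero, frontInsert_succ hi] at this
    simp only [Equiv.apply_symm_apply] at this
    rw [if_neg (by omega)] at this
    have := this (by omega) (by omega)
    omega
  · intro hm
    refine ⟨by omega, fun a b hab ha hb => ?_⟩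
    obtain ⟨b, rfl⟩ := Fin.eq_succ_of_ne_zero (Fin.ne_zero_of_lt hab)
    rw [frontInsert_succ hi] at hb
    rw [Fin.lt_def, frontInsert_succ hi]
    rcases Fin.eq_zero_or_eq_succ a with rfl | ⟨a, rfl⟩
    · rw [frontInsert_zero] at ha; omega
    · rw [frontInsert_succ hi] at ha ⊢
      have := hp.2 a b (by simpa using hab)
      split_ifs at ha hb ⊢ <;> omega

/-! ### Refined sums and their recurrence. -/

open Classical in
/-- The sum of `φ` over the `123`-avoiding permutations whose `m` largest entries appear in
decreasing order. -/
noncomputable def topSum (n m : ℕ) (φ : Equiv.Perm (Fin n) → ℚ) : ℚ :=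
  ∑ p, if Avoids123 p ∧ TopDecreasing m p then φ p else 0

lemma topSum_eq_zero {n m : ℕ} (h : n < m) (φ : Equiv.Perm (Fin n) → ℚ) : topSum n m φ = 0 :=
  Finset.sum_eq_zero fun _ _ => if_neg fun hp => absurd hp.2.1 (by omega)

lemma topSum_congr {n m : ℕ} {φ ψ : Equiv.Perm (Fin n) → ℚ} (h : ∀ p, φ p = ψ p) :
    topSum n m φ = topSum n m ψ := by
  rw [funext h]

lemma topSum_add {n m : ℕ} (φ ψ : Equiv.Perm (Fin n) → ℚ) :
    topSum n m (fun p => φ p + ψ p) = topSum n m φ + topSum n m ψ := by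
  simp only [topSum, ← Finset.sum_add_distrib]
  exact Finset.sum_congr rfl fun p _ => by split_ifs <;> simp

lemma topSum_const {n m : ℕ} (c : ℚ) :
    topSum n m (fun _ => c) = c * topSum n m (fun _ => 1) := by
  simp only [topSum, Finset.mul_sum, mul_ite, mul_one, mul_zero]

/-- A single largest entry is trivially decreasing. This boundary condition supplies `m = 0`, which
the recurrence does not reach. -/
lemma topSum_succ_zero {n : ℕ} (φ : Equiv.Perm (Fin (n + 1)) → ℚ) :
    topSum (n + 1) 0 φ = topSum (n + 1) 1 φ := by
  classical
  exact Finset.sum_congr rfl fun p _ => if_congr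
    (and_congr_right fun _ => iff_of_true (topDecreasing_zero p) (topDecreasing_one p)) rfl rfl

lemma topSum_succ_succ {n m : ℕ} (φ : Equiv.Perm (Fin (n + 1)) → ℚ) :
    topSum (n + 1) (m + 1) φ = topSum n m (fun p => φ (frontInsert 0 p)) +
      ∑ i ∈ Finset.Ico (m + 1) (n + 1), topSum n i (fun p => φ (frontInsert i p)) := by
  classical
  rw [topSum, sum_perm_succ, Finset.range_eq_Ico, Finset.sum_eq_sum_Ico_succ_bot n.succ_pos]
  congr 1
  · refine Finset.sum_congr rfl fun p _ => ?_
    simp only [avoids123_frontInsert n.zero_le, topDecreasing_frontInsert_zero,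
      topDecreasing_zero, and_true]
  · have hsub : Finset.Ico (m + 1) (n + 1) ⊆ Finset.Ico (0 + 1) (n + 1) :=
      Finset.Ico_subset_Ico (by omega) le_rfl
    have hterm : ∀ i ∈ Finset.Ico (0 + 1) (n + 1), ∀ p : Equiv.Perm (Fin n),
        (Avoids123 (frontInsert i p) ∧ TopDecreasing (m + 1) (frontInsert i p)) ↔
          (Avoids123 p ∧ TopDecreasing i p) ∧ m + 1 ≤ i := by
      intro i hi p
      rw [Finset.mem_Ico] at hi
      rw [avoids123_frontInsert (by omega)]
      exact and_congr_right fun h => topDecreasing_frontInsert (by omega) h.2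
    rw [← Finset.sum_subset hsub]
    · refine Finset.sum_congr rfl fun i hi => Finset.sum_congr rfl fun p _ => ?_
      rw [Finset.mem_Ico] at hi
      exact if_congr ((hterm i (Finset.mem_Ico.2 ⟨by omega, hi.2⟩) p).trans
        (and_iff_left hi.1)) rfl rfl
    · intro i hi hi'
      refine Finset.sum_eq_zero fun p _ => if_neg fun h => hi' ?_
      rw [Finset.mem_Ico] at hi ⊢
      exact ⟨((hterm i (Finset.mem_Ico.2 hi) p).1 h).2, hi.2⟩

/-- The two sums over `i` differ only in the term `i = m + 1`. -/
lemma topSum_succ_sub {n m : ℕ} (φ : Equiv.Perm (Fin (n + 1)) → ℚ) :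
    topSum (n + 1) (m + 1) φ - topSum (n + 1) (m + 2) φ =
      topSum n m (fun p => φ (frontInsert 0 p)) - topSum n (m + 1) (fun p => φ (frontInsert 0 p)) +
        topSum n (m + 1) (fun p => φ (frontInsert (m + 1) p)) := by
  rw [topSum_succ_succ, topSum_succ_succ]
  rcases lt_or_ge n (m + 1) with h | h
  · rw [Finset.Ico_eq_empty (by omega), Finset.Ico_eq_empty (by omega),
      topSum_eq_zero h fun p => φ (frontInsert (m + 1) p)]
    simp
  · rw [Finset.sum_eq_sum_Ico_succ_bot (by omega : m + 1 < n + 1)]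
    ring

/-! ### Crossing pairs and occurrences of 213 under insertion. -/

/-- The number of pairs of positions `a < c` such that the entry at `c` is among the `j` largest
entries of `p` while the entry at `a` is not. -/
def crossPairs {n : ℕ} (j : ℕ) (p : Equiv.Perm (Fin n)) : ℕ :=
  ∑ a, ∑ c, if a < c ∧ (p a : ℕ) + j < n ∧ n ≤ (p c : ℕ) + j then 1 else 0

lemma crossPairs_zero {n : ℕ} (p : Equiv.Perm (Fin n)) : crossPairs 0 p = 0 :=
  Finset.sum_eq_zero fun a _ => Finset.sum_eq_zero fun c _ => if_neg (by omega)

lemma sum_top_entries {n j : ℕ} (hj : j ≤ n) (p : Equiv.Perm (Fin n)) :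
    (∑ c, if n ≤ (p c : ℕ) + j then 1 else 0) = j := by
  rw [Equiv.sum_comp p (fun x : Fin n => if n ≤ (x : ℕ) + j then 1 else 0),
    ← Finset.sum_range (fun x => if n ≤ x + j then 1 else 0), ← Finset.card_filter]
  have : (Finset.range n).filter (fun x => n ≤ x + j) = Finset.Ico (n - j) n := by
    ext x
    simp only [Finset.mem_filter, Finset.mem_range, Finset.mem_Ico]
    omega
  rw [this, Nat.card_Ico]
  omega

/-- Since `j ≤ i`, the new entry lies below the top `j` and precedes them all, giving `j` new pairs.
-/
lemma crossPairs_frontInsert {n i j : ℕ} (hi : i ≤ n) (hj : j ≤ i) (p : Equiv.Perm (Fin n)) :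
    crossPairs j (frontInsert i p) = crossPairs j p + j := by
  rw [crossPairs, Fin.sum_univ_succ, add_comm]
  congr 1
  · refine Finset.sum_congr rfl fun a _ => ?_
    rw [Fin.sum_univ_succ, if_neg (by simp), zero_add]
    refine Finset.sum_congr rfl fun c _ => if_congr ?_ rfl rfl
    rw [Fin.succ_lt_succ_iff, frontInsert_succ hi, frontInsert_succ hi]
    split_ifs <;> omega
  · rw [Fin.sum_univ_succ, if_neg (by simp), zero_add]
    conv_rhs => rw [← sum_top_entries (hj.trans hi) p]
    refine Finset.sum_congr rfl fun c _ => if_congr ?_ rfl rfl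
    have := Fin.succ_pos c
    rw [frontInsert_zero, frontInsert_succ hi]
    split_ifs <;> omega

/-- The new maximum takes one of the `j + 1` top places and, standing first, belongs to no pair. -/
lemma crossPairs_succ_frontInsert_zero {n j : ℕ} (p : Equiv.Perm (Fin n)) :
    crossPairs (j + 1) (frontInsert 0 p) = crossPairs j p := by
  rw [crossPairs, Fin.sum_univ_succ, Finset.sum_eq_zero, zero_add]
  · refine Finset.sum_congr rfl fun a _ => ?_
    rw [Fin.sum_univ_succ, if_neg (by simp), zero_add]
    refine Finset.sum_congr rfl fun c _ => if_congr ?_ rfl rfl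
    rw [Fin.succ_lt_succ_iff, frontInsert_succ n.zero_le, frontInsert_succ n.zero_le]
    split_ifs <;> omega
  · intro c _
    rw [frontInsert_zero]
    exact if_neg (by omega)

lemma numOcc_pat213 {n : ℕ} (p : Equiv.Perm (Fin n)) :
    numOcc pat213 p =
      ∑ a, ∑ b, ∑ c, if a < b ∧ b < c ∧ p b < p a ∧ p a < p c then 1 else 0 := by
  have key : numOcc pat213 p = ((Finset.univ : Finset (Fin n × Fin n × Fin n)).filter fun x =>
      x.1 < x.2.1 ∧ x.2.1 < x.2.2 ∧ p x.2.1 < p x.1 ∧ p x.1 < p x.2.2).card := by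
    refine Finset.card_bij' (fun f _ => (f 0, f 1, f 2)) (fun x _ => ![x.1, x.2.1, x.2.2])
      ?_ ?_ ?_ ?_
    · intro f hf
      obtain ⟨h1, h2⟩ := (Finset.mem_filter.1 hf).2
      exact Finset.mem_filter.2 ⟨Finset.mem_univ _, h1 _ _ (by decide), h1 _ _ (by decide),
        (h2 _ _).2 (by decide), (h2 _ _).2 (by decide)⟩
    · rintro ⟨a, b, c⟩ hx
      obtain ⟨hab, hbc, pba, pac⟩ := (Finset.mem_filter.1 hx).2
      simp only at hab hbc pba pac
      have hac := hab.trans hbc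
      have pbc := pba.trans pac
      refine Finset.mem_filter.2 ⟨Finset.mem_univ _, fun i j hij => ?_, fun i j => ?_⟩
      · fin_cases i <;> fin_cases j <;> simp_all
      · fin_cases i <;> fin_cases j <;>
          simp [pat213, Equiv.swap_apply_def, pba, pac, pbc, pba.le, pac.le, pbc.le]
    · intro f _
      ext i
      fin_cases i <;> rfl
    · intro x _
      rfl
  rw [key, Finset.card_filter, Fintype.sum_prod_type]
  exact Finset.sum_congr rfl fun a _ => Fintype.sum_prod_type _

/-- As the first letter of a 213, the new entry needs a smaller entry followed by a larger one, that
is, a crossing pair for the top `i` entries of `p`. -/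
lemma numOcc_pat213_frontInsert {n i : ℕ} (hi : i ≤ n) (p : Equiv.Perm (Fin n)) :
    numOcc pat213 (frontInsert i p) = numOcc pat213 p + crossPairs i p := by
  rw [numOcc_pat213, Fin.sum_univ_succ, add_comm, numOcc_pat213]
  congr 1
  · refine Finset.sum_congr rfl fun a _ => ?_
    rw [Fin.sum_univ_succ, Finset.sum_eq_zero (by simp), zero_add]
    refine Finset.sum_congr rfl fun b _ => ?_
    rw [Fin.sum_univ_succ, if_neg (by simp), zero_add]
    refine Finset.sum_congr rfl fun c _ => if_congr ?_ rfl rfl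
    simp only [Fin.succ_lt_succ_iff, Fin.lt_def (a := frontInsert i p _), frontInsert_succ hi]
    split_ifs <;> omega
  · rw [Fin.sum_univ_succ, Finset.sum_eq_zero (by simp), zero_add]
    refine Finset.sum_congr rfl fun b _ => ?_
    rw [Fin.sum_univ_succ, if_neg (by simp), zero_add]
    refine Finset.sum_congr rfl fun c _ => if_congr ?_ rfl rfl
    simp only [Fin.succ_lt_succ_iff, Fin.succ_pos, true_and, Fin.lt_def (a := frontInsert i p _),
      frontInsert_succ hi, frontInsert_zero]
    split_ifs <;> omega

/-! ### Recurrences for the three sums. -/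

lemma topSum_one_succ_sub (n m : ℕ) :
    topSum (n + 1) (m + 1) (fun _ => 1) - topSum (n + 1) (m + 2) (fun _ => 1) =
      topSum n m (fun _ => 1) := by
  rw [topSum_succ_sub]
  ring

lemma topSum_crossPairs_succ_sub (n m j : ℕ) (hj : j ≤ m) :
    topSum (n + 1) (m + 1) (fun p => (crossPairs (j + 1) p : ℚ)) -
        topSum (n + 1) (m + 2) (fun p => (crossPairs (j + 1) p : ℚ)) =
      topSum n m (fun p => (crossPairs j p : ℚ)) -
        topSum n (m + 1) (fun p => (crossPairs j p : ℚ)) +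
        topSum n (m + 1) (fun p => (crossPairs (j + 1) p : ℚ)) +
        (j + 1) * topSum n (m + 1) (fun _ => 1) := by
  rw [topSum_succ_sub]
  simp only [crossPairs_succ_frontInsert_zero]
  rw [add_assoc, ← topSum_const, ← topSum_add]
  rcases lt_or_ge n (m + 1) with h | h
  · simp only [topSum_eq_zero h]
  · congr 1
    refine topSum_congr fun p => ?_
    rw [crossPairs_frontInsert h (by omega)]
    push_cast
    ring

lemma topSum_numOcc_succ_sub (n m : ℕ) :
    topSum (n + 1) (m + 1) (fun p => (numOcc pat213 p : ℚ)) -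
        topSum (n + 1) (m + 2) (fun p => (numOcc pat213 p : ℚ)) =
      topSum n m (fun p => (numOcc pat213 p : ℚ)) +
        topSum n (m + 1) (fun p => (crossPairs (m + 1) p : ℚ)) := by
  rw [topSum_succ_sub]
  simp only [numOcc_pat213_frontInsert n.zero_le, crossPairs_zero, add_zero]
  rcases lt_or_ge n (m + 1) with h | h
  · simp only [topSum_eq_zero h, sub_zero]
  · simp only [numOcc_pat213_frontInsert h, Nat.cast_add, topSum_add]
    ring

lemma totalOcc_eq_topSum (n : ℕ) :
    (totalOcc pat213 (Av n pat123) : ℚ) = topSum n 0 (fun p => (numOcc pat213 p : ℚ)) := by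
  classical
  rw [totalOcc, Nat.cast_sum, topSum, ← Finset.sum_filter]
  refine Finset.sum_congr ?_ fun _ _ => rfl
  ext p
  rw [mem_Av_pat123, Finset.mem_filter_univ, and_iff_left (topDecreasing_zero p)]

/-! ### The Catalan series and powers of `1 - 4x`. -/

lemma catalanGF_eq : X * catalanGF ^ 2 + 1 = catalanGF := by
  have h : catalanGF = PowerSeries.map (Nat.castRingHom ℚ) catalanSeries := by
    ext n
    simp [catalanGF]
  have := congrArg (PowerSeries.map (Nat.castRingHom ℚ)) catalanSeries_sq_mul_X_add_one
  simp only [map_add, map_mul, map_pow, map_one, PowerSeries.map_X, ← h] at this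
  rw [mul_comm, this]

lemma catalanGF_mul_one_sub : catalanGF * (1 - X * catalanGF) = 1 := by
  linear_combination -catalanGF_eq

lemma X_eq_catalanGF : (X : ℚ⟦X⟧) = X * catalanGF * (1 - X * catalanGF) := by
  linear_combination -X * catalanGF_mul_one_sub

lemma constantCoeff_one_sub_two_mul :
    constantCoeff (1 - 2 * (X * catalanGF) : ℚ⟦X⟧) = 1 := by
  simp

lemma oneSubFourXPow_add (r s : ℚ) :
    oneSubFourXPow (r + s) = oneSubFourXPow r * oneSubFourXPow s := by
  simp [oneSubFourXPow]

lemma oneSubFourXPow_one : oneSubFourXPow 1 = 1 - 4 * X := by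
  have h := binomialSeries_nat (R := ℚ) (A := ℚ) 1
  rw [Nat.cast_one, pow_one] at h
  rw [oneSubFourXPow, h, map_add, map_one, rescale_X]
  have : PowerSeries.C (-4 : ℚ) = -4 := by rw [map_neg, map_ofNat]
  rw [this]
  ring

/-- Both sides square to `1 - 4x`; the constant term 1 fixes the sign. -/
lemma oneSubFourXPow_half : oneSubFourXPow (1 / 2) = 1 - 2 * (X * catalanGF) := by
  have hsq : oneSubFourXPow (1 / 2) ^ 2 = (1 - 2 * (X * catalanGF)) ^ 2 := by
    rw [sq, ← oneSubFourXPow_add, add_halves, oneSubFourXPow_one]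
    linear_combination -4 * X * catalanGF_eq
  rcases sq_eq_sq_iff_eq_or_eq_neg.1 hsq with h | h
  · exact h
  · have := congrArg constantCoeff h
    rw [map_neg, constantCoeff_one_sub_two_mul, oneSubFourXPow,
      ← coeff_zero_eq_constantCoeff_apply, coeff_rescale, coeff_zero_eq_constantCoeff_apply,
      binomialSeries_constantCoeff] at this
    norm_num at this

lemma oneSubFourXPow_three_halves :
    oneSubFourXPow (3 / 2) = (1 - 2 * (X * catalanGF)) ^ 3 := by
  rw [show (3 / 2 : ℚ) = 1 / 2 + 1 / 2 + 1 / 2 by norm_num, oneSubFourXPow_add,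
    oneSubFourXPow_add, oneSubFourXPow_half]
  ring

/-! ### Closed forms for the generating functions. -/

lemma coeff_X_mul_pow_mul_of_lt {n m : ℕ} (h : n < m) (F G : ℚ⟦X⟧) :
    coeff n ((X * F) ^ m * G) = 0 := by
  rw [mul_pow, mul_assoc]
  exact X_pow_dvd_iff.1 (dvd_mul_right _ _) n h

/-- A sequence that vanishes eventually and is constant from `l` on vanishes from `l` on. -/
lemma eq_zero_of_eq_succ {D : ℕ → ℚ} {N l : ℕ} (hN : ∀ m, N < m → D m = 0)
    (hD : ∀ m, l ≤ m → D m = D (m + 1)) (m : ℕ) (hm : l ≤ m) : D m = 0 := by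
  have : ∀ d, D m = D (m + d) := by
    intro d
    induction d with
    | zero => rfl
    | succ d ih => rw [ih, hD _ (by omega), add_assoc]
  rw [this (N + 1), hN _ (by omega)]

/-- Both sides vanish for `m > n` and, given the case `n`, have the same differences in `m` at `n +
1`, so they agree for `m ≥ 1`. The next two closed forms are proved by the same scheme. -/
lemma topSum_one_eq_coeff (n m : ℕ) :
    topSum n m (fun _ => 1) = coeff n ((X * catalanGF) ^ m * catalanGF) := by
  induction n generalizing m with
  | zero =>
    rcases m.eq_zero_or_pos with rfl | hm
    · have : ∀ p : Equiv.Perm (Fin 0), Avoids123 p ∧ TopDecreasing 0 p := fun p =>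
        ⟨fun a => a.elim0, topDecreasing_zero p⟩
      simp [topSum, this, catalanGF]
    · rw [topSum_eq_zero hm, coeff_X_mul_pow_mul_of_lt hm]
  | succ n ih =>
    have key : ∀ m, 1 ≤ m → topSum (n + 1) m (fun _ => 1) -
        coeff (n + 1) ((X * catalanGF) ^ m * catalanGF) = 0 := by
      refine eq_zero_of_eq_succ (N := n + 1) (fun m hm => ?_) (fun m hm => ?_)
      · rw [topSum_eq_zero hm, coeff_X_mul_pow_mul_of_lt hm, sub_zero]
      · obtain ⟨m, rfl⟩ := Nat.exists_eq_add_of_le' hm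
        have h1 := topSum_one_succ_sub n m
        have h2 : (X * catalanGF) ^ (m + 1) * catalanGF - (X * catalanGF) ^ (m + 2) * catalanGF =
            X * ((X * catalanGF) ^ m * catalanGF) := by
          linear_combination (X * catalanGF) ^ (m + 1) * catalanGF_mul_one_sub
        have h3 := congrArg (coeff (n + 1)) h2
        rw [map_sub, coeff_succ_X_mul, ← ih] at h3
        linarith
    rcases m.eq_zero_or_pos with rfl | hm
    · rw [topSum_succ_zero, sub_eq_zero.1 (key 1 le_rfl)]
      have h2 : (X * catalanGF) ^ 0 * catalanGF = (X * catalanGF) ^ 1 * catalanGF + 1 := by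
        linear_combination catalanGF_mul_one_sub
      rw [h2, map_add, coeff_one, if_neg n.succ_ne_zero, add_zero]
    · exact sub_eq_zero.1 (key m hm)

/-- The identity behind the recurrence for the generating functions of `crossPairs`. -/
lemma crossPairs_series_identity {A : Type*} [CommRing A] {x t c e : A} (hc : c * (1 - t) = 1)
    (hx : x = t * (1 - t)) (he : 6 * e = 1) (j : A) (m : ℕ) :
    t ^ (m + 1) * (3 * e * (j + 1) * (j + 2) * ((c - 1) * c)) -
        t ^ (m + 2) * (3 * e * (j + 1) * (j + 2) * ((c - 1) * c)) =
      x * (t ^ m * (3 * e * j * (j + 1) * ((c - 1) * c)) -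
        t ^ (m + 1) * (3 * e * j * (j + 1) * ((c - 1) * c)) +
        t ^ (m + 1) * (3 * e * (j + 1) * (j + 2) * ((c - 1) * c)) +
        (j + 1) * (t ^ (m + 1) * c)) := by
  -- Here `e` is 1/6, so `3 * e` is the 1/2 of `j(j+1)/2`; sixths are used because the cubic for
  -- `numOcc` needs them.
  subst hx
  linear_combination c * t ^ (m + 1) * (1 - t) * (j + 1) * (6 * e * hc + t * he)

lemma six_mul_C_sixth : 6 * PowerSeries.C (1 / 6 : ℚ) = 1 := by
  rw [← map_ofNat PowerSeries.C 6, ← map_mul]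
  norm_num

lemma topSum_crossPairs_eq_coeff (n m j : ℕ) (hj : j ≤ m) :
    topSum n m (fun p => (crossPairs j p : ℚ)) =
      coeff n ((X * catalanGF) ^ m * (3 * PowerSeries.C (1 / 6 : ℚ) * (j : ℚ⟦X⟧) *
        ((j : ℚ⟦X⟧) + 1) * ((catalanGF - 1) * catalanGF))) := by
  induction n generalizing m j with
  | zero =>
    cases j with
    | zero => simp [crossPairs_zero, topSum]
    | succ j =>
      rw [topSum_eq_zero (by omega), coeff_X_mul_pow_mul_of_lt (by omega)]
  | succ n ih =>
    cases j with
    | zero => simp [crossPairs_zero, topSum]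
    | succ j =>
      refine sub_eq_zero.1 (eq_zero_of_eq_succ (N := n + 1) (l := j + 1)
        (D := fun m => topSum (n + 1) m (fun p => (crossPairs (j + 1) p : ℚ)) -
          coeff (n + 1) ((X * catalanGF) ^ m * (3 * PowerSeries.C (1 / 6 : ℚ) *
            ((j + 1 : ℕ) : ℚ⟦X⟧) * (((j + 1 : ℕ) : ℚ⟦X⟧) + 1) * ((catalanGF - 1) * catalanGF))))
        (fun m hm => ?_) (fun m hm => ?_) m hj)
      · rw [topSum_eq_zero hm, coeff_X_mul_pow_mul_of_lt hm, sub_zero]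
      · obtain ⟨m, rfl⟩ := Nat.exists_eq_add_of_le' (by omega : 1 ≤ m)
        have h1 := topSum_crossPairs_succ_sub n m j (by omega)
        have h3 := congrArg (coeff (n + 1)) (crossPairs_series_identity catalanGF_mul_one_sub
          X_eq_catalanGF six_mul_C_sixth (j : ℚ⟦X⟧) m)
        rw [map_sub, coeff_succ_X_mul, map_add, map_add, map_sub, ← ih m j (by omega),
          ← ih (m + 1) j (by omega),
          show (j : ℚ⟦X⟧) + 1 = PowerSeries.C ((j : ℚ) + 1) by simp, coeff_C_mul,
          ← topSum_one_eq_coeff, ← show (j : ℚ⟦X⟧) + 1 = PowerSeries.C ((j : ℚ) + 1) by simp] at h3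
        have h4 := ih (m + 1) (j + 1) (by omega)
        push_cast at h4 ⊢
        rw [add_assoc (j : ℚ⟦X⟧) 1 1, one_add_one_eq_two] at h4 ⊢
        linarith

/-- The identity behind the recurrence for the generating functions of occurrences of `213`. -/
lemma numOcc_series_identity {A : Type*} [CommRing A] {x t c e u : A} (hc : c * (1 - t) = 1)
    (hx : x = t * (1 - t)) (he : 6 * e = 1) (hu : u * (1 - 2 * t) = 1) {Q : A → A}
    (hQ : ∀ k, Q k = e * t ^ 2 * c * u * k ^ 3 + 3 * e * t ^ 2 * u ^ 2 * k ^ 2 +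
      (3 * e * t ^ 2 * u ^ 3 - e * t ^ 2 * c * u) * k + t ^ 3 * u ^ 3) :
    Q 0 = t * Q 1 ∧ ∀ (k : A) (m : ℕ), t ^ (m + 1) * Q (k + 1) - t ^ (m + 2) * Q (k + 2) =
      x * (t ^ m * Q k + t ^ (m + 1) * (3 * e * (k + 1) * (k + 2) * ((c - 1) * c))) := by
  have hcu : c * (u + 1) = 2 * u := by
    linear_combination 2 * u * hc - c * hu
  -- The coefficients of the cubic `Q` are made opaque. The recurrence, expanded in powers of `k +
  -- 1`, amounts to `hsa` (square), `hsb` (linear) and `hsg` (constant). It leaves `d` free, and `Q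
  -- 0 = t * Q 1` determines it.
  obtain ⟨a, ha⟩ : ∃ a, a = e * t ^ 2 * c * u := ⟨_, rfl⟩
  obtain ⟨b, hb⟩ : ∃ b, b = 3 * e * t ^ 2 * u ^ 2 := ⟨_, rfl⟩
  obtain ⟨g, hg⟩ : ∃ g, g = 3 * e * t ^ 2 * u ^ 3 - a := ⟨_, rfl⟩
  obtain ⟨d, hd⟩ : ∃ d, d = t ^ 3 * u ^ 3 := ⟨_, rfl⟩
  rw [← hd, ← ha, ← hb, ← hg] at hQ
  have hsa : (1 - 2 * t) * a = e * t ^ 2 * c := by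
    rw [ha]; linear_combination e * t ^ 2 * c * hu
  have hsb : 2 * b * (1 - 2 * t) = 3 * a + 3 * e * t ^ 2 * c := by
    rw [ha, hb]; linear_combination 6 * e * t ^ 2 * u * hu - 3 * e * t ^ 2 * hcu
  have hsg : (1 - 2 * t) * g = b - (1 - 2 * t) * a := by
    rw [hg, hb]; linear_combination 3 * e * t ^ 2 * u ^ 2 * hu
  constructor
  · rw [hQ, hQ]
    have : t * (a + b + g) = (1 - t) * d := by
      rw [hg, hb, hd]
      linear_combination -3 * e * t ^ 3 * u ^ 2 * hu + t ^ 3 * u ^ 3 * (1 - t) * he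
    linear_combination -this
  · intro k m
    subst hx
    rw [hQ, hQ, hQ]
    linear_combination t ^ (m + 1) * (3 * (k + 1) ^ 2 * hsa + (k + 1) * hsb + hsg -
      3 * e * (k + 1) * (k + 2) * t * c * hc)

lemma topSum_numOcc_eq_coeff {u : ℚ⟦X⟧} (hu : u * (1 - 2 * (X * catalanGF)) = 1)
    {Q : ℚ⟦X⟧ → ℚ⟦X⟧}
    (hQ : ∀ k, Q k = PowerSeries.C (1 / 6 : ℚ) * (X * catalanGF) ^ 2 * catalanGF * u * k ^ 3 +
      3 * PowerSeries.C (1 / 6 : ℚ) * (X * catalanGF) ^ 2 * u ^ 2 * k ^ 2 +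
      (3 * PowerSeries.C (1 / 6 : ℚ) * (X * catalanGF) ^ 2 * u ^ 3 -
        PowerSeries.C (1 / 6 : ℚ) * (X * catalanGF) ^ 2 * catalanGF * u) * k +
      (X * catalanGF) ^ 3 * u ^ 3) (n m : ℕ) :
    topSum n m (fun p => (numOcc pat213 p : ℚ)) = coeff n ((X * catalanGF) ^ m * Q m) := by
  obtain ⟨hQ0, hQs⟩ := numOcc_series_identity catalanGF_mul_one_sub X_eq_catalanGF six_mul_C_sixth hu hQ
  induction n generalizing m with
  | zero =>
    rcases m.eq_zero_or_pos with rfl | hm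
    · simp [topSum, numOcc_pat213, hQ]
    · rw [topSum_eq_zero hm, coeff_X_mul_pow_mul_of_lt hm]
  | succ n ih =>
    have key : ∀ m, 1 ≤ m → topSum (n + 1) m (fun p => (numOcc pat213 p : ℚ)) -
        coeff (n + 1) ((X * catalanGF) ^ m * Q m) = 0 := by
      refine eq_zero_of_eq_succ (N := n + 1) (fun m hm => ?_) (fun m hm => ?_)
      · rw [topSum_eq_zero hm, coeff_X_mul_pow_mul_of_lt hm, sub_zero]
      · obtain ⟨m, rfl⟩ := Nat.exists_eq_add_of_le' hm
        have h1 := topSum_numOcc_succ_sub n m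
        have h3 := congrArg (coeff (n + 1)) (hQs (m : ℚ⟦X⟧) m)
        rw [map_sub, coeff_succ_X_mul, map_add, ← ih] at h3
        have h4 := topSum_crossPairs_eq_coeff n (m + 1) (m + 1) le_rfl
        push_cast at h4 ⊢
        rw [add_assoc (m : ℚ⟦X⟧) 1 1, one_add_one_eq_two] at h4 ⊢
        linarith
    rcases m.eq_zero_or_pos with rfl | hm
    · rw [topSum_succ_zero, sub_eq_zero.1 (key 1 le_rfl), Nat.cast_zero, hQ0]
      simp
    · exact sub_eq_zero.1 (key m hm)

theorem mainTheorem1 :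
    (PowerSeries.mk fun n => (totalOcc pat213 (Av n pat123) : ℚ)) =
        X ^ 3 * catalanGF ^ 3 * (oneSubFourXPow (3 / 2))⁻¹ ∧
      X ^ 3 * catalanGF ^ 3 * (oneSubFourXPow (3 / 2))⁻¹ =
        (X - 1) * (2 * (1 - 4 * X))⁻¹ - (3 * X - 1) * (2 * oneSubFourXPow (3 / 2))⁻¹ := by
  obtain ⟨u, hu⟩ : ∃ u : ℚ⟦X⟧, u * (1 - 2 * (X * catalanGF)) = 1 :=
    ⟨_, PowerSeries.inv_mul_cancel _ (by rw [constantCoeff_one_sub_two_mul]; exact one_ne_zero)⟩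
  have hinv : ∀ {f g : ℚ⟦X⟧}, f * g = 1 → f⁻¹ = g := fun {f g} h => by
    have hf : constantCoeff f ≠ 0 := fun h0 => by
      have := congrArg constantCoeff h
      simp [h0] at this
    exact ((PowerSeries.eq_inv_iff_mul_eq_one hf).2 (by rw [mul_comm, h])).symm
  have hs3 : (oneSubFourXPow (3 / 2))⁻¹ = u ^ 3 := hinv <| by
    rw [oneSubFourXPow_three_halves, ← mul_pow, mul_comm, hu, one_pow]
  obtain ⟨h, hh⟩ : ∃ h : ℚ⟦X⟧, 2 * h = 1 := ⟨PowerSeries.C (1 / 2), by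
    rw [← map_ofNat PowerSeries.C 2, ← map_mul]
    norm_num⟩
  have hs2 : (1 - 2 * (X * catalanGF)) ^ 2 = 1 - 4 * X := by
    linear_combination 4 * X * catalanGF_eq
  have h2s2 : (2 * (1 - 4 * X) : ℚ⟦X⟧)⁻¹ = h * u ^ 2 := hinv <| by
    rw [← hs2, mul_mul_mul_comm, hh, ← mul_pow, mul_comm _ u, hu, one_pow, one_mul]
  have h2s3 : (2 * oneSubFourXPow (3 / 2))⁻¹ = h * u ^ 3 := hinv <| by
    rw [oneSubFourXPow_three_halves, mul_mul_mul_comm, hh, ← mul_pow, mul_comm _ u, hu, one_pow,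
      one_mul]
  constructor
  · ext n
    -- At `m = 0` only the constant term `t³u³` of the cubic survives.
    rw [coeff_mk, totalOcc_eq_topSum, topSum_numOcc_eq_coeff hu (fun _ => rfl), hs3]
    congr 1
    simp only [pow_zero, one_mul, Nat.cast_zero]
    ring
  · rw [hs3, h2s2, h2s3]
    have hx := X_eq_catalanGF
    have hnum : 2 * (X ^ 3 * catalanGF ^ 3) =
        (X - 1) * (1 - 2 * (X * catalanGF)) - 3 * X + 1 := by
      -- After `X = T(1 - T)` this is a polynomial identity in `T`.
      generalize hT : X * catalanGF = T at hx
      rw [← mul_pow, hT, hx]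
      ring
    linear_combination h * u ^ 3 * hnum + (X - 1) * h * u ^ 2 * hu -
      X ^ 3 * catalanGF ^ 3 * u ^ 3 * hh
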